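/- **Theorem 5.** A Kreweras walk is a lattice walk in $\mathbb{Z}^2$ that starts at $(0,0)$, uses only the steps $(-1,0)$, $(0,-1)$, $(1,1)$, and never leaves $\mathbb{N}^2$. Let $f(n;i,j)$ be the number of Kreweras walks with $n$ steps ending at $(i,j)$, and let $$F(t;x,y)=\sum_{n\ge 0}\Bigl(\sum_{i,j\ge 0} f(n;i,j)\,x^i y^j\Bigr)t^n\in\mathbb{Q}[x,y][[t]].$$ Then: 1. $F(t;x,y)$ is algebraic, i.e. it is a root of a nonzero polynomial in one variable $T$ with coefficients in $\mathbb{Q}[x,y][t]$. 2. Let $$\begin{aligned}P(T,t,x)={}&(16x^3t^4+108t^4-72xt^3+8x^2t^2-2t+x)\\&+(96x^2t^5-48x^3t^4-144t^4+104xt^3-16x^2t^2+2t-x)\,T\\&+(48x^4t^6+192xt^6-264x^2t^5+64x^3t^4+32t^4-32xt^3+9x^2t^2)\,T^2\\&+(192x^3t^7+128t^7-96x^4t^6-192xt^6+128x^2t^5-32x^3t^4)\,T^3\\&+(48x^5t^8+192x^2t^8-192x^3t^7+56x^4t^6)\,T^4+(96x^4t^9-48x^5t^8)\,T^5+16x^6t^{10}\,T^6,\end{aligned}$$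 a polynomial of degree $6$ in $T$. The section $F(t;x,0)$ is a root of $P(T,t,x)$, and it is the only root of $P$ in $\mathbb{Q}[[x,t]]$. 3. Let $$h(U,x)=U^6x^3+3U^4(U+1)^2x^2+3U^2(U+1)^4x+1+6U+15U^2+24U^3+27U^4+18U^5+5U^6,$$ $$R_1(U,x)=\frac{U(1+U)(1+2U+U^2+U^2x)^2}{h(U,x)},\qquad R_2(U,x)=\frac{\bigl(U^4x^2+2U^2(U+1)^2x+1+4U+6U^2+2U^3-U^4\bigr)h(U,x)}{(1+U)^2(1+2U+U^2+U^2x)^4}.$$ Then $P(R_2(U,x),R_1(U,x),x)=0$ in $\mathbb{Q}(x)(U)$; there is exactly one power series $U_0(t,x)\in\mathbb{Q}[[x,t]]$ with $U_0(0,x)=0$ and $R_1(U_0,x)=t$; and $F(t;x,0)=R_2(U_0(t,x),x)$. -/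

import Mathlib

open Polynomial PowerSeries

/-- The admissible steps `←`, `↓`, `↗`. -/
def krewerasSteps : Finset (ℤ × ℤ) := {(-1, 0), (0, -1), (1, 1)}

/-- The point reached after the first `k` steps of the step sequence `w`, starting at `(0, 0)`. -/
def walkPos {n : ℕ} (w : Fin n → krewerasSteps) (k : ℕ) : ℤ × ℤ :=
  ∑ m : Fin n, if (m : ℕ) < k then (w m : ℤ × ℤ) else 0

/-- Kreweras walks of length `n` ending at `(i, j)`: sequences of `n` admissible steps such that
the walk from the origin never leaves the first quadrant and ends at `(i, j)`. -/
def KrewerasWalk (n : ℕ) (i j : ℤ) : Type :=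
  {w : Fin n → krewerasSteps //
    (∀ k ≤ n, 0 ≤ (walkPos w k).1 ∧ 0 ≤ (walkPos w k).2) ∧ walkPos w n = (i, j)}

/-- The number `f(n; i, j)` of Kreweras walks with `n` steps ending at `(i, j)`. -/
noncomputable def krewerasCount (n : ℕ) (i j : ℤ) : ℕ := Nat.card (KrewerasWalk n i j)

theorem walkPos_le {n : ℕ} (w : Fin n → krewerasSteps) (k : ℕ) :
    (walkPos w k).1 ≤ n ∧ (walkPos w k).2 ≤ n := by
  have key : ∀ s : krewerasSteps, (s : ℤ × ℤ).1 ≤ 1 ∧ (s : ℤ × ℤ).2 ≤ 1 := by decide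
  have bound : ∀ g : Fin n → ℤ, (∀ m, g m ≤ 1) → ∑ m, g m ≤ n := fun g hg => by
    simpa using Finset.sum_le_sum fun m (_ : m ∈ Finset.univ) => hg m
  constructor
  · rw [walkPos, Prod.fst_sum]
    refine bound _ fun m => ?_
    split_ifs
    · exact (key (w m)).1
    · exact zero_le_one
  · rw [walkPos, Prod.snd_sum]
    refine bound _ fun m => ?_
    split_ifs
    · exact (key (w m)).2
    · exact zero_le_one

/-- `f(n; i, j)` vanishes unless `0 ≤ i, j ≤ n`, so that the sum over all `i, j` is the finite sum
used in `krewerasGF`. -/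
theorem krewerasCount_eq_zero {n : ℕ} {i j : ℤ} (h : i < 0 ∨ j < 0 ∨ n < i ∨ n < j) :
    krewerasCount n i j = 0 := by
  have : IsEmpty (KrewerasWalk n i j) := by
    refine ⟨fun ⟨w, hw, he⟩ => ?_⟩
    have h1 := hw n le_rfl
    have h2 := walkPos_le w n
    rw [he] at h1 h2
    simp only at h1 h2
    omega
  exact Nat.card_of_isEmpty

/-- The complete generating function `F(t; x, y) = ∑ₙ (∑_{i,j} f(n; i, j) xⁱ yʲ) tⁿ` in
`ℚ[x, y][[t]]`; here `x` is `MvPolynomial.X 0` and `y` is `MvPolynomial.X 1`. -/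
noncomputable def krewerasGF : PowerSeries (MvPolynomial (Fin 2) ℚ) :=
  PowerSeries.mk fun n =>
    ∑ i ∈ Finset.range (n + 1), ∑ j ∈ Finset.range (n + 1),
      MvPolynomial.C (krewerasCount n i j : ℚ) * MvPolynomial.X 0 ^ i * MvPolynomial.X 1 ^ j

/-- The section `F(t; x, 0)` in `ℚ[x][[t]]`, obtained by substituting `y = 0`. -/
noncomputable def krewerasSection : PowerSeries (Polynomial ℚ) :=
  PowerSeries.map
    (MvPolynomial.aeval ![(Polynomial.X : Polynomial ℚ), 0]).toRingHom krewerasGF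

/-- The section `F(t; x, 0)` viewed in `ℚ[[x, t]] = ℚ[[x]][[t]]`. -/
noncomputable def krewerasSectionSeries : PowerSeries (PowerSeries ℚ) :=
  PowerSeries.map Polynomial.coeToPowerSeries.ringHom krewerasSection

/-- The polynomial `P(T, t, x)`, evaluated at elements of a commutative ring. -/
def krewerasP {R : Type*} [CommRing R] (T t x : R) : R :=
  (16 * x ^ 3 * t ^ 4 + 108 * t ^ 4 - 72 * x * t ^ 3 + 8 * x ^ 2 * t ^ 2 - 2 * t + x)
  + (96 * x ^ 2 * t ^ 5 - 48 * x ^ 3 * t ^ 4 - 144 * t ^ 4 + 104 * x * t ^ 3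
      - 16 * x ^ 2 * t ^ 2 + 2 * t - x) * T
  + (48 * x ^ 4 * t ^ 6 + 192 * x * t ^ 6 - 264 * x ^ 2 * t ^ 5 + 64 * x ^ 3 * t ^ 4
      + 32 * t ^ 4 - 32 * x * t ^ 3 + 9 * x ^ 2 * t ^ 2) * T ^ 2
  + (192 * x ^ 3 * t ^ 7 + 128 * t ^ 7 - 96 * x ^ 4 * t ^ 6 - 192 * x * t ^ 6
      + 128 * x ^ 2 * t ^ 5 - 32 * x ^ 3 * t ^ 4) * T ^ 3
  + (48 * x ^ 5 * t ^ 8 + 192 * x ^ 2 * t ^ 8 - 192 * x ^ 3 * t ^ 7 + 56 * x ^ 4 * t ^ 6) * T ^ 4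
  + (96 * x ^ 4 * t ^ 9 - 48 * x ^ 5 * t ^ 8) * T ^ 5
  + 16 * x ^ 6 * t ^ 10 * T ^ 6

/-- The polynomial `h(U, x)`. -/
def krewerasH {R : Type*} [CommRing R] (U x : R) : R :=
  U ^ 6 * x ^ 3 + 3 * U ^ 4 * (U + 1) ^ 2 * x ^ 2 + 3 * U ^ 2 * (U + 1) ^ 4 * x
    + 1 + 6 * U + 15 * U ^ 2 + 24 * U ^ 3 + 27 * U ^ 4 + 18 * U ^ 5 + 5 * U ^ 6

/-- The rational function `R₁(U, x)`. -/
def krewerasR₁ {K : Type*} [Field K] (U x : K) : K :=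
  U * (1 + U) * (1 + 2 * U + U ^ 2 + U ^ 2 * x) ^ 2 / krewerasH U x

/-- The rational function `R₂(U, x)`. -/
def krewerasR₂ {K : Type*} [Field K] (U x : K) : K :=
  (U ^ 4 * x ^ 2 + 2 * U ^ 2 * (U + 1) ^ 2 * x + 1 + 4 * U + 6 * U ^ 2 + 2 * U ^ 3 - U ^ 4)
      * krewerasH U x
    / ((1 + U) ^ 2 * (1 + 2 * U + U ^ 2 + U ^ 2 * x) ^ 4)

/-- The inclusion of `ℚ[[x, t]] = ℚ[[x]][[t]]` in its field of fractions. -/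
noncomputable def toFrac :
    PowerSeries (PowerSeries ℚ) →+* FractionRing (PowerSeries (PowerSeries ℚ)) :=
  algebraMap _ _

/-- The variable `t` of `ℚ[[x, t]] = ℚ[[x]][[t]]`. -/
noncomputable def serT : PowerSeries (PowerSeries ℚ) := PowerSeries.X

/-- The variable `x` of `ℚ[[x, t]] = ℚ[[x]][[t]]`. -/
noncomputable def serX : PowerSeries (PowerSeries ℚ) := PowerSeries.C PowerSeries.X

/-!
The generating function of Kreweras walks has an explicit closed form. Removing the last step of a
walk shows that `F` satisfies the kernel equation
`x y F = x y + t ((x + y + x² y²) F - x F(t; x, 0) - y F(t; 0, y))`,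
and this equation determines the coefficients of `tⁿ` recursively. It therefore suffices to exhibit
one solution.

The solution comes from the invariant `1/x² - 1/(t x) - x`, which takes the same value at `x` and at
`y` on the curve where the kernel `x y - t (x + y + x² y²)` vanishes. Let `W = t (2 + W³)`. Up to a
constant in `x`, the invariant is the square of `A(x) = (1/W - 1/x) √(1 - x W²)`, so the difference
`A(x)² - A(y)²` is divisible by the kernel. If `t x F(t; x, 0) = 1/(2t) - 1/x - A(x)`, the kernel
equation then gives
`F = ((1/x - 1/y) / (A(y) - A(x)) - 1) / (t x y)`.
To stay inside `ℚ[x, y][[t]]`, write `√(1 - x W²) = 1 - x W² c`, where `2 c = 1 + x W² c²`, define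
`d` in the same way from `y`, and let `δ = (c - d) / (x - y)`, which is again a power series. With
`E = c + (y - W) δ` the formula becomes `(1 - x y W E) F = (2 + W³) E`
(`exists_isKrewerasParam_krewerasGF`). That it solves the kernel equation is a polynomial identity
in `x, y, W, c, d` modulo the two quadratic equations, once `δ` and the denominators are cleared
(`closedForm_kernel_equation`).

All three assertions follow. Every series in the closed form is algebraic, hence so is `F`. At
`y = 0` the closed form reduces to `F(t; x, 0) = (2 + W³) (c - W³ c² / 2)`; since
`t = W / (2 + W³)` and `x = (2 c - 1) / (W² c²)`, the vanishing of `P(F(t; x, 0), t, x)` is an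
identity between rational functions of `W` and `c` (`krewerasP_eq_zero_of_param`), and the root is
unique because `∂P/∂T` is `-x` modulo `t`. Finally `U / (1 + U) = c W` relates the two rational
parametrizations (`krewerasR_of_param`), so the existence and uniqueness of `U₀` reduce to those of
`W` and `c`.
-/

/-! ### Fixed points of contractions of power series -/

theorem two_ne_zero_of_algebra_rat (R : Type*) [CommRing R] [Nontrivial R] [Algebra ℚ R] :
    (2 : R) ≠ 0 := by
  have : (2 : R) = algebraMap ℚ R 2 := (_root_.map_ofNat _ 2).symm
  rw [this]
  exact (_root_.map_ne_zero _).2 two_ne_zero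

theorem isUnit_two_of_algebra_rat (R : Type*) [CommRing R] [Algebra ℚ R] : IsUnit (2 : R) := by
  have : (2 : R) = algebraMap ℚ R 2 := (_root_.map_ofNat _ 2).symm
  rw [this]
  exact (IsUnit.mk0 (2 : ℚ) two_ne_zero).map _

/-- A map of power series that gains a factor `X` on differences has exactly one fixed point. -/
theorem existsUnique_fixedPoint_of_X_mul_sub_dvd {R : Type*} [CommRing R] (Φ : R⟦X⟧ → R⟦X⟧)
    (hΦ : ∀ A B, PowerSeries.X * (A - B) ∣ Φ A - Φ B) : ∃! A, Φ A = A := by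
  have step : ∀ (n : ℕ) (A B : R⟦X⟧), (PowerSeries.X : R⟦X⟧) ^ n ∣ A - B →
      (PowerSeries.X : R⟦X⟧) ^ (n + 1) ∣ Φ A - Φ B := fun n A B h => by
    rw [pow_succ']
    exact (mul_dvd_mul_left _ h).trans (hΦ A B)
  have sep : ∀ A B : R⟦X⟧, (∀ n, (PowerSeries.X : R⟦X⟧) ^ n ∣ A - B) → A = B := fun A B h => by
    ext n
    have := PowerSeries.X_pow_dvd_iff.1 (h (n + 1)) n n.lt_succ_self
    rwa [map_sub, sub_eq_zero] at this
  have iter : ∀ n, (PowerSeries.X : R⟦X⟧) ^ n ∣ Φ^[n + 1] 0 - Φ^[n] 0 := fun n => by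
    induction n with
    | zero => simp
    | succ n ih =>
      simpa only [Function.iterate_succ_apply'] using step n _ _ ih
  have cauchy : ∀ n k, (PowerSeries.X : R⟦X⟧) ^ n ∣ Φ^[n + k] 0 - Φ^[n] 0 := fun n k => by
    induction k with
    | zero => simp
    | succ k ih =>
      have h := ((pow_dvd_pow _ (Nat.le_add_right n k)).trans (iter (n + k))).add ih
      rwa [sub_add_sub_cancel] at h
  -- the `n`-th coefficient of the iterates is stationary from the `(n + 1)`-st iterate on
  let A : R⟦X⟧ := PowerSeries.mk fun n => PowerSeries.coeff n (Φ^[n + 1] 0)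
  have approx : ∀ n, (PowerSeries.X : R⟦X⟧) ^ n ∣ A - Φ^[n] 0 := fun n => by
    rw [PowerSeries.X_pow_dvd_iff]
    intro m hm
    obtain ⟨k, rfl⟩ := Nat.exists_eq_add_of_le (Nat.succ_le_of_lt hm)
    have h := PowerSeries.X_pow_dvd_iff.1 (cauchy (m + 1) k) m m.lt_succ_self
    rw [map_sub, sub_eq_zero] at h ⊢
    rw [PowerSeries.coeff_mk, ← h]
  have hA : Φ A = A := sep _ _ fun n => by
    have h1 := (pow_dvd_pow (PowerSeries.X : R⟦X⟧) n.le_succ).trans (step n _ _ (approx n))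
    have h2 := (pow_dvd_pow (PowerSeries.X : R⟦X⟧) n.le_succ).trans (approx (n + 1))
    rw [Function.iterate_succ_apply'] at h2
    simpa using h1.sub h2
  refine ⟨A, hA, fun B hB => sep _ _ fun n => ?_⟩
  induction n with
  | zero => simp
  | succ n ih => simpa [hB, hA] using step n _ _ ih

/-- The equation `W = t (2 + W³)` has exactly one power series solution. -/
theorem existsUnique_eq_X_mul_two_add_cube (R : Type*) [CommRing R] :
    ∃! W : R⟦X⟧, PowerSeries.X * (2 + W ^ 3) = W :=
  existsUnique_fixedPoint_of_X_mul_sub_dvd _ fun A B =>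
    ⟨A ^ 2 + A * B + B ^ 2, by ring⟩

/-- The quadratic equation `2 c = 1 + x W² c²`, whose solution is `c = (1 - √(1 - x W²)) / (x W²)`,
has exactly one power series solution when `W` has no constant term. -/
theorem existsUnique_two_mul_eq {R : Type*} [CommRing R] [Algebra ℚ R] (x : R⟦X⟧) {W : R⟦X⟧}
    (hW : PowerSeries.X ∣ W) : ∃! c : R⟦X⟧, 2 * c = 1 + x * W ^ 2 * c ^ 2 := by
  obtain ⟨V, rfl⟩ := hW
  set h : R⟦X⟧ := algebraMap ℚ R⟦X⟧ (1 / 2) with hh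
  have h2 : h * 2 = 1 := by
    have : (2 : R⟦X⟧) = algebraMap ℚ R⟦X⟧ 2 := (_root_.map_ofNat _ 2).symm
    rw [hh, this, ← map_mul]
    norm_num
  have key := existsUnique_fixedPoint_of_X_mul_sub_dvd
    (fun c : R⟦X⟧ => h * (1 + x * (PowerSeries.X * V) ^ 2 * c ^ 2)) fun A B =>
    ⟨h * x * PowerSeries.X * V ^ 2 * (A + B), by ring⟩
  refine (existsUnique_congr fun c => ⟨fun H => ?_, fun H => ?_⟩).1 key
  · linear_combination (-2 : R⟦X⟧) * H + (1 + x * (PowerSeries.X * V) ^ 2 * c ^ 2) * h2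
  · linear_combination (-h) * H + c * h2

theorem X_dvd_of_X_mul_two_add_cube {R : Type*} [CommRing R] {W : R⟦X⟧}
    (hW : PowerSeries.X * (2 + W ^ 3) = W) : PowerSeries.X ∣ W := ⟨_, hW.symm⟩

theorem ne_zero_of_X_mul_two_add_cube {R : Type*} [CommRing R] [Algebra ℚ R] [IsDomain R]
    {W : R⟦X⟧} (hW : PowerSeries.X * (2 + W ^ 3) = W) : W ≠ 0 := by
  rintro rfl
  have h2 : (2 : R⟦X⟧) ≠ 0 := two_ne_zero_of_algebra_rat _
  simp [PowerSeries.X_ne_zero, h2] at hW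

/-! ### The kernel equation of Kreweras walks -/

theorem walkPos_snoc_of_le {n : ℕ} (w : Fin n → krewerasSteps) (s : krewerasSteps) {k : ℕ}
    (hk : k ≤ n) : walkPos (Fin.snoc w s : Fin (n + 1) → krewerasSteps) k = walkPos w k := by
  simp [walkPos, Fin.sum_univ_castSucc, Nat.not_lt.2 hk]

theorem walkPos_snoc_succ {n : ℕ} (w : Fin n → krewerasSteps) (s : krewerasSteps) :
    walkPos (Fin.snoc w s : Fin (n + 1) → krewerasSteps) (n + 1) = walkPos w n + s := by
  simp [walkPos, Fin.sum_univ_castSucc]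

/-- Removing the last step of a Kreweras walk that ends in the quadrant. -/
def krewerasWalkSuccEquiv (n : ℕ) {i j : ℤ} (hi : 0 ≤ i) (hj : 0 ≤ j) :
    KrewerasWalk (n + 1) i j ≃
      Σ s : krewerasSteps, KrewerasWalk n (i - (s : ℤ × ℤ).1) (j - (s : ℤ × ℤ).2) :=
  ((Fin.snocEquiv fun _ : Fin (n + 1) => krewerasSteps).subtypeEquiv
    (p := fun p => (∀ k ≤ n, 0 ≤ (walkPos p.2 k).1 ∧ 0 ≤ (walkPos p.2 k).2) ∧
      walkPos p.2 n = (i - (p.1 : ℤ × ℤ).1, j - (p.1 : ℤ × ℤ).2)) (by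
    rintro ⟨s, w⟩
    change _ ↔ (∀ k ≤ n + 1, 0 ≤ (walkPos (Fin.snoc w s : Fin (n + 1) → krewerasSteps) k).1 ∧
      0 ≤ (walkPos (Fin.snoc w s : Fin (n + 1) → krewerasSteps) k).2) ∧
      walkPos (Fin.snoc w s : Fin (n + 1) → krewerasSteps) (n + 1) = (i, j)
    have hend : walkPos (Fin.snoc w s : Fin (n + 1) → krewerasSteps) (n + 1) = (i, j) ↔
        walkPos w n = (i - (s : ℤ × ℤ).1, j - (s : ℤ × ℤ).2) := by
      rw [walkPos_snoc_succ, ← eq_sub_iff_add_eq]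
      rfl
    rw [hend]
    refine and_congr_left fun he => ⟨fun h k hk => ?_, fun h k hk => ?_⟩
    · rcases Nat.le_succ_iff.1 hk with hk | rfl
      · rw [walkPos_snoc_of_le w s hk]
        exact h k hk
      · rw [hend.2 he]
        exact ⟨hi, hj⟩
    · have := h k (hk.trans n.le_succ)
      rwa [walkPos_snoc_of_le w s hk] at this)).symm.trans
  (Equiv.subtypeProdEquivSigmaSubtype fun (s : krewerasSteps) (w : Fin n → krewerasSteps) =>
    (∀ k ≤ n, 0 ≤ (walkPos w k).1 ∧ 0 ≤ (walkPos w k).2) ∧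
      walkPos w n = (i - (s : ℤ × ℤ).1, j - (s : ℤ × ℤ).2))

instance (n : ℕ) (i j : ℤ) : Finite (KrewerasWalk n i j) := by
  unfold KrewerasWalk
  infer_instance

/-- The recurrence obtained by removing the last step. -/
theorem krewerasCount_succ (n : ℕ) {i j : ℤ} (hi : 0 ≤ i) (hj : 0 ≤ j) :
    krewerasCount (n + 1) i j =
      krewerasCount n (i + 1) j + krewerasCount n i (j + 1) + krewerasCount n (i - 1) (j - 1) := by
  rw [krewerasCount, Nat.card_congr (krewerasWalkSuccEquiv n hi hj), Nat.card_sigma]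
  change ∑ s : krewerasSteps, krewerasCount n (i - (s : ℤ × ℤ).1) (j - (s : ℤ × ℤ).2) = _
  rw [Finset.sum_coe_sort krewerasSteps fun s : ℤ × ℤ => krewerasCount n (i - s.1) (j - s.2)]
  simp [krewerasSteps, add_assoc]

theorem krewerasCount_zero : krewerasCount 0 0 0 = 1 := by
  have : Unique (KrewerasWalk 0 0 0) :=
    { default := ⟨Fin.elim0, by simp [walkPos, Prod.ext_iff]⟩
      uniq := fun w => Subtype.ext (Subsingleton.elim _ _) }
  exact Nat.card_unique

/-- The substitution `x = 0` in `ℚ[x, y]`. -/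
noncomputable def substXZero : MvPolynomial (Fin 2) ℚ →+* MvPolynomial (Fin 2) ℚ :=
  (MvPolynomial.aeval ![0, MvPolynomial.X 1]).toRingHom

/-- The substitution `y = 0` in `ℚ[x, y]`. -/
noncomputable def substYZero : MvPolynomial (Fin 2) ℚ →+* MvPolynomial (Fin 2) ℚ :=
  (MvPolynomial.aeval ![MvPolynomial.X 0, 0]).toRingHom

@[simp] theorem substXZero_X_zero : substXZero (MvPolynomial.X 0) = 0 := by simp [substXZero]
@[simp] theorem substXZero_X_one : substXZero (MvPolynomial.X 1) = MvPolynomial.X 1 := by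
  simp [substXZero]
@[simp] theorem substYZero_X_zero : substYZero (MvPolynomial.X 0) = MvPolynomial.X 0 := by
  simp [substYZero]
@[simp] theorem substYZero_X_one : substYZero (MvPolynomial.X 1) = 0 := by simp [substYZero]

/-- The ranges of the sums that define `krewerasGF` may be enlarged. -/
theorem coeff_krewerasGF {n M N : ℕ} (hM : n < M) (hN : n < N) :
    PowerSeries.coeff n krewerasGF = ∑ i ∈ Finset.range M, ∑ j ∈ Finset.range N,
      MvPolynomial.C (krewerasCount n i j : ℚ) * MvPolynomial.X 0 ^ i * MvPolynomial.X 1 ^ j := by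
  rw [krewerasGF, PowerSeries.coeff_mk]
  have hj : ∀ i : ℕ, ∑ j ∈ Finset.range (n + 1), MvPolynomial.C (krewerasCount n i j : ℚ) *
      MvPolynomial.X (0 : Fin 2) ^ i * MvPolynomial.X 1 ^ j = ∑ j ∈ Finset.range N,
      MvPolynomial.C (krewerasCount n i j : ℚ) * MvPolynomial.X 0 ^ i * MvPolynomial.X 1 ^ j := by
    intro i
    refine Finset.sum_subset (Finset.range_mono hN) fun j _ hj => ?_
    rw [Finset.mem_range] at hj
    rw [krewerasCount_eq_zero (by omega)]
    simp
  simp only [hj]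
  refine Finset.sum_subset (Finset.range_mono hM) fun i _ hi => ?_
  rw [Finset.mem_range] at hi
  refine Finset.sum_eq_zero fun j _ => ?_
  rw [krewerasCount_eq_zero (by omega)]
  simp

theorem coeff_zero_krewerasGF : PowerSeries.coeff 0 krewerasGF = 1 := by
  simp [krewerasGF, krewerasCount_zero]

theorem coeff_sub_substXZero (n N : ℕ) (hN : n < N) :
    PowerSeries.coeff n krewerasGF - substXZero (PowerSeries.coeff n krewerasGF) =
      MvPolynomial.X 0 * ∑ i ∈ Finset.range N, ∑ j ∈ Finset.range N,
        MvPolynomial.C (krewerasCount n (i + 1) j : ℚ) * MvPolynomial.X 0 ^ i *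
          MvPolynomial.X 1 ^ j := by
  rw [coeff_krewerasGF (hN.trans N.lt_succ_self) hN, Finset.sum_range_succ', map_add, map_sum]
  have h0 : ∀ i : ℕ, substXZero (∑ j ∈ Finset.range N,
      MvPolynomial.C (krewerasCount n ↑(i + 1) j : ℚ) * MvPolynomial.X 0 ^ (i + 1) *
        MvPolynomial.X 1 ^ j) = 0 := fun i => by simp
  rw [Finset.sum_eq_zero fun i _ => h0 i]
  have h1 : substXZero (∑ j ∈ Finset.range N,
      MvPolynomial.C (krewerasCount n ((0 : ℕ) : ℤ) j : ℚ) * MvPolynomial.X 0 ^ 0 *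
        MvPolynomial.X 1 ^ j) =
      ∑ j ∈ Finset.range N,
        MvPolynomial.C (krewerasCount n ((0 : ℕ) : ℤ) j : ℚ) * MvPolynomial.X 0 ^ 0 *
          MvPolynomial.X 1 ^ j := by simp
  rw [h1, zero_add, add_sub_cancel_right, Finset.mul_sum]
  refine Finset.sum_congr rfl fun i _ => ?_
  rw [Finset.mul_sum]
  refine Finset.sum_congr rfl fun j _ => ?_
  push_cast
  ring

theorem coeff_sub_substYZero (n N : ℕ) (hN : n < N) :
    PowerSeries.coeff n krewerasGF - substYZero (PowerSeries.coeff n krewerasGF) =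
      MvPolynomial.X 1 * ∑ i ∈ Finset.range N, ∑ j ∈ Finset.range N,
        MvPolynomial.C (krewerasCount n i (j + 1) : ℚ) * MvPolynomial.X 0 ^ i *
          MvPolynomial.X 1 ^ j := by
  rw [coeff_krewerasGF hN (hN.trans N.lt_succ_self), map_sum, ← Finset.sum_sub_distrib,
    Finset.mul_sum]
  refine Finset.sum_congr rfl fun i _ => ?_
  rw [Finset.sum_range_succ', map_add, map_sum]
  have h0 : ∀ j : ℕ, substYZero (MvPolynomial.C (krewerasCount n i ↑(j + 1) : ℚ) *
      MvPolynomial.X 0 ^ i * MvPolynomial.X 1 ^ (j + 1)) = 0 := fun i => by simp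
  rw [Finset.sum_eq_zero fun i _ => h0 i]
  have h1 : substYZero (MvPolynomial.C (krewerasCount n i ((0 : ℕ) : ℤ) : ℚ) *
      MvPolynomial.X 0 ^ i * MvPolynomial.X 1 ^ 0) =
      MvPolynomial.C (krewerasCount n i ((0 : ℕ) : ℤ) : ℚ) *
      MvPolynomial.X 0 ^ i * MvPolynomial.X 1 ^ 0 := by simp
  rw [h1, zero_add, add_sub_cancel_right, Finset.mul_sum]
  refine Finset.sum_congr rfl fun j _ => ?_
  push_cast
  ring

theorem X_mul_X_mul_coeff_krewerasGF (n N : ℕ) (hN : n < N) :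
    MvPolynomial.X 0 * MvPolynomial.X 1 * PowerSeries.coeff n krewerasGF =
      ∑ i ∈ Finset.range (N + 1), ∑ j ∈ Finset.range (N + 1),
        MvPolynomial.C (krewerasCount n (i - 1) (j - 1) : ℚ) * MvPolynomial.X 0 ^ i *
          MvPolynomial.X 1 ^ j := by
  rw [coeff_krewerasGF hN hN, Finset.sum_range_succ', Finset.mul_sum]
  have h0 : ∀ j : ℕ, krewerasCount n (0 - 1) ((j : ℤ) - 1) = 0 := fun j =>
    krewerasCount_eq_zero (by omega)
  have h1 : ∀ i : ℕ, krewerasCount n ((i : ℤ) - 1) (((0 : ℕ) : ℤ) - 1) = 0 := fun j =>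
    krewerasCount_eq_zero (by omega)
  simp only [h0, Nat.cast_zero, map_zero, zero_mul, Finset.sum_const_zero, add_zero]
  refine Finset.sum_congr rfl fun i _ => ?_
  rw [Finset.sum_range_succ', h1, Finset.mul_sum]
  simp only [Nat.cast_zero, map_zero, zero_mul, add_zero]
  refine Finset.sum_congr rfl fun j _ => ?_
  push_cast
  rw [add_sub_cancel_right, add_sub_cancel_right]
  ring

/-- The coefficient form of the functional equation: a walk of length `n + 1` arises from one of
length `n` by a step `←` (not from the `y`-axis), `↓` (not from the `x`-axis) or `↗`. -/
theorem coeff_succ_krewerasGF (n : ℕ) :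
    MvPolynomial.X 0 * MvPolynomial.X 1 * PowerSeries.coeff (n + 1) krewerasGF =
      (MvPolynomial.X 0 + MvPolynomial.X 1 + MvPolynomial.X 0 ^ 2 * MvPolynomial.X 1 ^ 2) *
          PowerSeries.coeff n krewerasGF
        - MvPolynomial.X 0 * substYZero (PowerSeries.coeff n krewerasGF)
        - MvPolynomial.X 1 * substXZero (PowerSeries.coeff n krewerasGF) := by
  have h1 := coeff_sub_substXZero n (n + 2) (by omega)
  have h2 := coeff_sub_substYZero n (n + 2) (by omega)
  have h3 := X_mul_X_mul_coeff_krewerasGF n (n + 1) (by omega)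
  have h : PowerSeries.coeff (n + 1) krewerasGF =
      (∑ i ∈ Finset.range (n + 2), ∑ j ∈ Finset.range (n + 2),
        MvPolynomial.C (krewerasCount n (i + 1) j : ℚ) * MvPolynomial.X 0 ^ i *
          MvPolynomial.X 1 ^ j) +
      (∑ i ∈ Finset.range (n + 2), ∑ j ∈ Finset.range (n + 2),
        MvPolynomial.C (krewerasCount n i (j + 1) : ℚ) * MvPolynomial.X 0 ^ i *
          MvPolynomial.X 1 ^ j) +
      (∑ i ∈ Finset.range (n + 2), ∑ j ∈ Finset.range (n + 2),
        MvPolynomial.C (krewerasCount n (i - 1) (j - 1) : ℚ) * MvPolynomial.X 0 ^ i *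
          MvPolynomial.X 1 ^ j) := by
    rw [coeff_krewerasGF (Nat.lt_succ_self _) (Nat.lt_succ_self _)]
    simp only [← Finset.sum_add_distrib]
    refine Finset.sum_congr rfl fun i _ => Finset.sum_congr rfl fun j _ => ?_
    rw [krewerasCount_succ n (Nat.cast_nonneg i) (Nat.cast_nonneg j)]
    push_cast
    simp only [map_add]
    ring
  rw [h, ← h3]
  linear_combination (-MvPolynomial.X 1) * h1 - MvPolynomial.X 0 * h2

/-- The functional equation of Kreweras walks,
`x y G = x y + t ((x + y + x² y²) G - x G(x, 0) - y G(0, y))`. -/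
def SatisfiesKernelEquation (G : PowerSeries (MvPolynomial (Fin 2) ℚ)) : Prop :=
  PowerSeries.C (MvPolynomial.X 0 * MvPolynomial.X 1) * G =
    PowerSeries.C (MvPolynomial.X 0 * MvPolynomial.X 1) + PowerSeries.X *
      (PowerSeries.C (MvPolynomial.X 0 + MvPolynomial.X 1 +
          MvPolynomial.X 0 ^ 2 * MvPolynomial.X 1 ^ 2) * G
        - PowerSeries.C (MvPolynomial.X 0) * PowerSeries.map substYZero G
        - PowerSeries.C (MvPolynomial.X 1) * PowerSeries.map substXZero G)

theorem krewerasGF_satisfiesKernelEquation : SatisfiesKernelEquation krewerasGF := by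
  unfold SatisfiesKernelEquation
  refine PowerSeries.ext fun n => ?_
  cases n with
  | zero => 
    have h : PowerSeries.constantCoeff krewerasGF = 1 := by
      rw [← PowerSeries.coeff_zero_eq_constantCoeff_apply, coeff_zero_krewerasGF]
    simp [h]
  | succ n =>
    rw [LinearMap.map_add, PowerSeries.coeff_succ_X_mul]
    simp only [map_sub, PowerSeries.coeff_C_mul, PowerSeries.coeff_map]
    rw [coeff_succ_krewerasGF, PowerSeries.coeff_C, if_neg n.succ_ne_zero, zero_add]

/-- The functional equation determines the coefficients of `tⁿ` recursively. -/
theorem SatisfiesKernelEquation.unique {G H : PowerSeries (MvPolynomial (Fin 2) ℚ)}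
    (hG : SatisfiesKernelEquation G) (hH : SatisfiesKernelEquation H) : G = H := by
  have hxy : (MvPolynomial.X 0 * MvPolynomial.X 1 : MvPolynomial (Fin 2) ℚ) ≠ 0 :=
    mul_ne_zero (MvPolynomial.X_ne_zero 0) (MvPolynomial.X_ne_zero 1)
  refine PowerSeries.ext fun n => mul_left_cancel₀ hxy ?_
  rw [← PowerSeries.coeff_C_mul, ← PowerSeries.coeff_C_mul]
  induction n with
  | zero => rw [hG, hH]; simp
  | succ n ih =>
    rw [PowerSeries.coeff_C_mul, PowerSeries.coeff_C_mul] at ih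
    have ih' := mul_left_cancel₀ hxy ih
    rw [hG, hH, LinearMap.map_add, LinearMap.map_add, PowerSeries.coeff_succ_X_mul,
      PowerSeries.coeff_succ_X_mul]
    simp only [map_sub, PowerSeries.coeff_C_mul, PowerSeries.coeff_map, ih']

/-! ### The closed form -/

/-- The value at `y = 0` of the closed form of the generating function. -/
theorem two_mul_closedForm_of_eq_zero {B : Type*} [CommRing B] [IsDomain B]
    {W c d δ x y G : B} (hx : x ≠ 0) (hy : y = 0)
    (hc : 2 * c = 1 + x * W ^ 2 * c ^ 2) (hd : 2 * d = 1 + y * W ^ 2 * d ^ 2)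
    (hδ : c - d = (x - y) * δ)
    (hG : (1 - x * y * W * (c + (y - W) * δ)) * G = (2 + W ^ 3) * (c + (y - W) * δ)) :
    2 * G = (2 + W ^ 3) * (2 * c - W ^ 3 * c ^ 2) := by
  subst hy
  have h : 2 * δ = W ^ 2 * c ^ 2 := mul_left_cancel₀ hx (by
    linear_combination (-2 : B) * hδ + hc - hd)
  linear_combination (2 : B) * hG - (2 + W ^ 3) * W * h

/-- The closed form satisfies the kernel equation. -/
theorem closedForm_kernel_equation {B : Type*} [CommRing B] [IsDomain B]
    {W c d δ x y t G Gx Gy : B} (h2 : (2 : B) ≠ 0) (hW3 : 2 + W ^ 3 ≠ 0) (hxy : x - y ≠ 0)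
    (hu : 1 - x * y * W * (c + (y - W) * δ) ≠ 0) (ht : t * (2 + W ^ 3) = W)
    (hc : 2 * c = 1 + x * W ^ 2 * c ^ 2) (hd : 2 * d = 1 + y * W ^ 2 * d ^ 2)
    (hδ : c - d = (x - y) * δ)
    (hG : (1 - x * y * W * (c + (y - W) * δ)) * G = (2 + W ^ 3) * (c + (y - W) * δ))
    (hGx : 2 * Gx = (2 + W ^ 3) * (2 * c - W ^ 3 * c ^ 2))
    (hGy : 2 * Gy = (2 + W ^ 3) * (2 * d - W ^ 3 * d ^ 2)) :
    x * y * G = x * y + t * ((x + y + x ^ 2 * y ^ 2) * G - x * Gx - y * Gy) := by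
  set E := c + (y - W) * δ with hE
  set N := x * W * c + y * W * d - W ^ 2 * (c + d - 1) with hN
  have hS : 2 * W * (x * Gx + y * Gy) = (2 + W ^ 3) * (2 * N) := by
    rw [hN]
    linear_combination W * x * hGx + W * y * hGy + (2 + W ^ 3) * W ^ 2 * (hc + hd)
  have he : (x - y) * E = x * c - y * d - W * (c - d) := by
    rw [hE]
    linear_combination (-(y - W)) * hδ
  have hcore : (x * y * (2 + W ^ 3) - W * (x + y + x ^ 2 * y ^ 2)) *
        (x * c - y * d - W * (c - d)) =
      (x * y - N) * ((x - y) - x * y * W * (x * c - y * d - W * (c - d))) := by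
    rw [hN]
    linear_combination (y * (x - W) ^ 2) * hc - (x * (y - W) ^ 2) * hd
  have hne : 2 * (2 + W ^ 3) * (1 - x * y * W * E) * (x - y) ≠ 0 :=
    mul_ne_zero (mul_ne_zero (mul_ne_zero h2 hW3) hu) hxy
  refine mul_left_cancel₀ hne ?_
  linear_combination
    (-2 * (1 - x * y * W * E) * (x - y) * ((x + y + x ^ 2 * y ^ 2) * G - x * Gx - y * Gy)) * ht
    + 2 * (x - y) * (x * y * (2 + W ^ 3) - W * (x + y + x ^ 2 * y ^ 2)) * hG
    + (x - y) * (1 - x * y * W * E) * hS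
    + 2 * (2 + W ^ 3) * (x * y * (2 + W ^ 3) - W * (x + y + x ^ 2 * y ^ 2)
      + x * y * W * (x * y - N)) * he
    + 2 * (2 + W ^ 3) * hcore

/-- A parametrization of a power series `G` in `t` by algebraic series: `W = t (2 + W³)`, the
series `c`, `d` with `1 - x W² c = √(1 - x W²)` and `1 - y W² d = √(1 - y W²)`, and the divided
difference `δ = (c - d) / (x - y)`. -/
structure IsKrewerasParam {R : Type*} [CommRing R] (x y W c d δ G : R⟦X⟧) : Prop where
  eq_W : PowerSeries.X * (2 + W ^ 3) = W
  eq_c : 2 * c = 1 + x * W ^ 2 * c ^ 2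
  eq_d : 2 * d = 1 + y * W ^ 2 * d ^ 2
  eq_δ : c - d = (x - y) * δ
  eq_G : (1 - x * y * W * (c + (y - W) * δ)) * G = (2 + W ^ 3) * (c + (y - W) * δ)

theorem IsKrewerasParam.map {R S : Type*} [CommRing R] [CommRing S] (f : R →+* S)
    {x y W c d δ G : R⟦X⟧} (h : IsKrewerasParam x y W c d δ G) :
    IsKrewerasParam (PowerSeries.map f x) (PowerSeries.map f y) (PowerSeries.map f W)
      (PowerSeries.map f c) (PowerSeries.map f d) (PowerSeries.map f δ)
      (PowerSeries.map f G) := by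
  have h2 : PowerSeries.map f 2 = 2 := _root_.map_ofNat _ 2
  constructor
  · simpa [h2] using congrArg (PowerSeries.map f) h.eq_W
  · simpa [h2] using congrArg (PowerSeries.map f) h.eq_c
  · simpa [h2] using congrArg (PowerSeries.map f) h.eq_d
  · simpa [h2] using congrArg (PowerSeries.map f) h.eq_δ
  · simpa [h2] using congrArg (PowerSeries.map f) h.eq_G

/-- The parametrization is symmetric in `x` and `y`. -/
theorem IsKrewerasParam.symm {R : Type*} [CommRing R] {x y W c d δ G : R⟦X⟧}
    (h : IsKrewerasParam x y W c d δ G) : IsKrewerasParam y x W d c δ G where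
  eq_W := h.eq_W
  eq_c := h.eq_d
  eq_d := h.eq_c
  eq_δ := by linear_combination -h.eq_δ
  eq_G := by
    have hE : d + (x - W) * δ = c + (y - W) * δ := by linear_combination -h.eq_δ
    rw [hE, mul_comm y x]
    exact h.eq_G

theorem isUnit_closedForm_denom {R : Type*} [CommRing R] {x y W c δ : R⟦X⟧}
    (hW : PowerSeries.X * (2 + W ^ 3) = W) : IsUnit (1 - x * y * W * (c + (y - W) * δ)) := by
  rw [PowerSeries.isUnit_iff_constantCoeff]
  simp [PowerSeries.X_dvd_iff.1 (X_dvd_of_X_mul_two_add_cube hW)]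

theorem C_X_zero_sub_C_X_one_ne_zero : PowerSeries.C (MvPolynomial.X 0 : MvPolynomial (Fin 2) ℚ) -
    PowerSeries.C (MvPolynomial.X 1) ≠ 0 := fun h => by
  have := MvPolynomial.X_injective (PowerSeries.C_injective (sub_eq_zero.1 h))
  exact absurd this (by decide)

theorem exists_isKrewerasParam {R : Type*} [CommRing R] [Algebra ℚ R] (x y : R⟦X⟧) :
    ∃ W c d δ G : R⟦X⟧, IsKrewerasParam x y W c d δ G := by
  obtain ⟨W, hW, -⟩ := existsUnique_eq_X_mul_two_add_cube R
  have hdvd := X_dvd_of_X_mul_two_add_cube hW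
  obtain ⟨c, hc, -⟩ := existsUnique_two_mul_eq x hdvd
  obtain ⟨d, hd, -⟩ := existsUnique_two_mul_eq y hdvd
  have hW0 := PowerSeries.X_dvd_iff.1 hdvd
  have hq : IsUnit (2 - x * W ^ 2 * (c + d)) := by
    rw [PowerSeries.isUnit_iff_constantCoeff]
    simpa [hW0, _root_.map_ofNat] using isUnit_two_of_algebra_rat R
  obtain ⟨q, hq'⟩ := hq.exists_right_inv
  set δ := W ^ 2 * d ^ 2 * q with hδ_def
  have hδ : c - d = (x - y) * δ := hq.mul_left_cancel (by
    rw [hδ_def]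
    linear_combination hc - hd - (x - y) * W ^ 2 * d ^ 2 * hq')
  obtain ⟨u, hu'⟩ :=
    (isUnit_closedForm_denom (x := x) (y := y) (c := c) (δ := δ) hW).exists_right_inv
  exact ⟨W, c, d, δ, u * ((2 + W ^ 3) * (c + (y - W) * δ)), hW, hc, hd, hδ, by
    rw [← mul_assoc, hu', one_mul]⟩

/-- **Closed form of the generating function** of Kreweras walks. -/
theorem exists_isKrewerasParam_krewerasGF :
    ∃ W c d δ : PowerSeries (MvPolynomial (Fin 2) ℚ),
      IsKrewerasParam (PowerSeries.C (MvPolynomial.X 0)) (PowerSeries.C (MvPolynomial.X 1))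
        W c d δ krewerasGF := by
  obtain ⟨W, c, d, δ, G, h⟩ := exists_isKrewerasParam
    (PowerSeries.C (MvPolynomial.X 0 : MvPolynomial (Fin 2) ℚ)) (PowerSeries.C (MvPolynomial.X 1))
  suffices hG : SatisfiesKernelEquation G by
    rw [← hG.unique krewerasGF_satisfiesKernelEquation]
    exact ⟨W, c, d, δ, h⟩
  have h2 : (2 : PowerSeries (MvPolynomial (Fin 2) ℚ)) ≠ 0 := two_ne_zero_of_algebra_rat _
  have hX : ∀ i : Fin 2, PowerSeries.C (MvPolynomial.X i : MvPolynomial (Fin 2) ℚ) ≠ 0 := fun i =>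
    (map_ne_zero_iff _ PowerSeries.C_injective).2 (MvPolynomial.X_ne_zero i)
  have hW3 : 2 + W ^ 3 ≠ 0 := fun h0 => ne_zero_of_X_mul_two_add_cube h.eq_W (by
    rw [← h.eq_W, h0, mul_zero])
  -- specializing a variable fixes `W` and the series attached to the other variable
  have fixW : ∀ f : MvPolynomial (Fin 2) ℚ →+* MvPolynomial (Fin 2) ℚ, PowerSeries.map f W = W :=
    fun f => (existsUnique_eq_X_mul_two_add_cube _).unique (h.map f).eq_W h.eq_W
  have hGx : 2 * PowerSeries.map substYZero G = (2 + W ^ 3) * (2 * c - W ^ 3 * c ^ 2) := by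
    have hm := h.map substYZero
    simp only [PowerSeries.map_C, substYZero_X_zero, substYZero_X_one, fixW] at hm
    have fixc : PowerSeries.map substYZero c = c :=
      (existsUnique_two_mul_eq _ (X_dvd_of_X_mul_two_add_cube h.eq_W)).unique hm.eq_c h.eq_c
    rw [fixc] at hm
    exact two_mul_closedForm_of_eq_zero (hX 0) (map_zero _) hm.eq_c hm.eq_d hm.eq_δ hm.eq_G
  have hGy : 2 * PowerSeries.map substXZero G = (2 + W ^ 3) * (2 * d - W ^ 3 * d ^ 2) := by
    have hm := h.symm.map substXZero
    simp only [PowerSeries.map_C, substXZero_X_zero, substXZero_X_one, fixW] at hm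
    have fixd : PowerSeries.map substXZero d = d :=
      (existsUnique_two_mul_eq _ (X_dvd_of_X_mul_two_add_cube h.eq_W)).unique hm.eq_c h.eq_d
    rw [fixd] at hm
    exact two_mul_closedForm_of_eq_zero (hX 1) (map_zero _) hm.eq_c hm.eq_d hm.eq_δ hm.eq_G
  have key := closedForm_kernel_equation h2 hW3
    C_X_zero_sub_C_X_one_ne_zero (isUnit_closedForm_denom h.eq_W).ne_zero h.eq_W h.eq_c h.eq_d
    h.eq_δ h.eq_G hGx hGy
  unfold SatisfiesKernelEquation
  simpa only [map_mul, map_add, map_pow] using key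

/-! ### Algebraicity -/

theorem isAlgebraic_of_mul_two_add_cube {k B : Type*} [CommRing k] [CommRing B]
    [Algebra k B] {t : k} {W : B} (ht : t ≠ 0) (hW : algebraMap k B t * (2 + W ^ 3) = W) :
    IsAlgebraic k W := by
  refine ⟨Polynomial.C t * (2 + Polynomial.X ^ 3) - Polynomial.X, fun h => ht ?_, ?_⟩
  · simpa [Polynomial.coeff_X] using congrArg (fun q => Polynomial.coeff q 3) h
  · simp [_root_.map_ofNat, hW]

/-- A solution of `2 c = 1 + z c²` is algebraic as soon as `z` is, since `(1 - z c)² = 1 - z`. -/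
theorem isAlgebraic_of_two_mul_eq {k B : Type*} [CommRing k] [IsDomain k] [CommRing B] [IsDomain B]
    [Algebra k B] {z c : B} (hz : IsAlgebraic k z) (hz0 : z ≠ 0) (hc : 2 * c = 1 + z * c ^ 2) :
    IsAlgebraic k c := by
  have hsq : (1 - z * c) ^ 2 = 1 - z := by linear_combination (-z) * hc
  have hs : IsAlgebraic k (1 - z * c) := .of_pow two_pos (hsq ▸ isAlgebraic_one.sub hz)
  refine .of_mul (mem_nonZeroDivisors_of_ne_zero hz0) hz ?_
  simpa using isAlgebraic_one.sub hs

/-- The closed form of the generating function is algebraic. -/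
theorem isAlgebraic_closedForm {k B : Type*} [CommRing k] [IsDomain k] [CommRing B] [IsDomain B]
    [Algebra k B] {W c d δ x y G : B} (hx : IsAlgebraic k x) (hy : IsAlgebraic k y)
    (hW : IsAlgebraic k W) (hx0 : x ≠ 0) (hy0 : y ≠ 0) (hW0 : W ≠ 0) (hxy : x - y ≠ 0)
    (hu : 1 - x * y * W * (c + (y - W) * δ) ≠ 0)
    (hc : 2 * c = 1 + x * W ^ 2 * c ^ 2) (hd : 2 * d = 1 + y * W ^ 2 * d ^ 2)
    (hδ : c - d = (x - y) * δ)
    (hG : (1 - x * y * W * (c + (y - W) * δ)) * G = (2 + W ^ 3) * (c + (y - W) * δ)) :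
    IsAlgebraic k G := by
  have hcalg := isAlgebraic_of_two_mul_eq (hx.mul (hW.pow 2))
    (mul_ne_zero hx0 (pow_ne_zero 2 hW0)) hc
  have hdalg := isAlgebraic_of_two_mul_eq (hy.mul (hW.pow 2))
    (mul_ne_zero hy0 (pow_ne_zero 2 hW0)) hd
  have hδalg : IsAlgebraic k δ :=
    .of_mul (mem_nonZeroDivisors_of_ne_zero hxy) (hx.sub hy) (hδ ▸ hcalg.sub hdalg)
  have hE := hcalg.add ((hy.sub hW).mul hδalg)
  have h2 : IsAlgebraic k (2 : B) :=
    one_add_one_eq_two (R := B) ▸ isAlgebraic_one.add isAlgebraic_one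
  exact .of_mul (mem_nonZeroDivisors_of_ne_zero hu)
    (isAlgebraic_one.sub (((hx.mul hy).mul hW).mul hE)) (hG ▸ (h2.add (hW.pow 3)).mul hE)

theorem krewerasGF_isAlgebraic :
    IsAlgebraic (Polynomial (MvPolynomial (Fin 2) ℚ)) krewerasGF := by
  obtain ⟨W, c, d, δ, h⟩ := exists_isKrewerasParam_krewerasGF
  have hX : ∀ i : Fin 2, PowerSeries.C (MvPolynomial.X i : MvPolynomial (Fin 2) ℚ) ≠ 0 := fun i =>
    (map_ne_zero_iff _ PowerSeries.C_injective).2 (MvPolynomial.X_ne_zero i)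
  have halg : ∀ a : MvPolynomial (Fin 2) ℚ,
      IsAlgebraic (Polynomial (MvPolynomial (Fin 2) ℚ)) (PowerSeries.C a) := fun a => by
    have : PowerSeries.C a = algebraMap (Polynomial (MvPolynomial (Fin 2) ℚ)) _
        (Polynomial.C a) := by simp [PowerSeries.algebraMap_apply']
    rw [this]
    exact isAlgebraic_algebraMap _
  have hW : IsAlgebraic (Polynomial (MvPolynomial (Fin 2) ℚ)) W :=
    isAlgebraic_of_mul_two_add_cube (t := Polynomial.X) Polynomial.X_ne_zero
      (by simpa [PowerSeries.algebraMap_apply'] using h.eq_W)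
  exact isAlgebraic_closedForm (halg _) (halg _) hW (hX 0) (hX 1)
    (ne_zero_of_X_mul_two_add_cube h.eq_W) C_X_zero_sub_C_X_one_ne_zero
    (isUnit_closedForm_denom h.eq_W).ne_zero h.eq_c h.eq_d h.eq_δ h.eq_G

/-! ### Rational parametrizations of `P = 0` -/

theorem map_krewerasP {R S : Type*} [CommRing R] [CommRing S] (f : R →+* S) (T t x : R) :
    f (krewerasP T t x) = krewerasP (f T) (f t) (f x) := by
  simp [krewerasP, _root_.map_ofNat]

theorem map_krewerasH {R S : Type*} [CommRing R] [CommRing S] (f : R →+* S) (U x : R) :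
    f (krewerasH U x) = krewerasH (f U) (f x) := by
  simp [krewerasH, _root_.map_ofNat]

/-- The surface `P(T, t, x) = 0` is parametrized by the rational parameters `w` and `c`. -/
theorem krewerasP_eq_zero_of_param {K : Type*} [Field K] {w c t x T : K} (h2 : (2 : K) ≠ 0)
    (hw : w ≠ 0) (hc : c ≠ 0) (hw3 : 2 + w ^ 3 ≠ 0) (ht : t * (2 + w ^ 3) = w)
    (hx : 2 * c = 1 + x * w ^ 2 * c ^ 2) (hT : T = (2 + w ^ 3) * (c - w ^ 3 * c ^ 2 / 2)) :
    krewerasP T t x = 0 := by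
  have ht' : t = w / (2 + w ^ 3) := by rw [eq_div_iff hw3, ht]
  have hx' : x = (2 * c - 1) / (w ^ 2 * c ^ 2) := by
    rw [eq_div_iff (by positivity)]
    linear_combination -hx
  subst hT ht' hx'
  unfold krewerasP
  field_simp
  ring

/-- The substitution `w = 2U(1+U)/a`, `c = a/(2(1+U)²)` with `a = (1+U)² + U²x` carries the
parametrization by `(w, c)` to the one by `(U, x)`. -/
theorem krewerasR_of_param {K : Type*} [Field K] {w c U x : K} (h2 : (2 : K) ≠ 0)
    (hU : 1 + U ≠ 0) (ha : 1 + 2 * U + U ^ 2 + U ^ 2 * x ≠ 0) (hH : krewerasH U x ≠ 0)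
    (hw : w * (1 + 2 * U + U ^ 2 + U ^ 2 * x) = 2 * U * (1 + U))
    (hc : 2 * c * (1 + U) ^ 2 = 1 + 2 * U + U ^ 2 + U ^ 2 * x) :
    2 + w ^ 3 ≠ 0 ∧ krewerasR₁ U x * (2 + w ^ 3) = w ∧ 2 * c = 1 + x * w ^ 2 * c ^ 2 ∧
      krewerasR₂ U x = (2 + w ^ 3) * (c - w ^ 3 * c ^ 2 / 2) := by
  set a := 1 + 2 * U + U ^ 2 + U ^ 2 * x with ha_def
  have hHa : krewerasH U x = a ^ 3 + 4 * U ^ 3 * (1 + U) ^ 3 := by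
    rw [krewerasH, ha_def]; ring
  have hx : x * U ^ 2 = a - (1 + U) ^ 2 := by rw [ha_def]; ring
  have hw' : w = 2 * U * (1 + U) / a := by rw [eq_div_iff ha, hw]
  have hc' : c = a / (2 * (1 + U) ^ 2) := by
    rw [eq_div_iff (by positivity)]; linear_combination hc
  have hw3 : 2 + w ^ 3 = 2 * krewerasH U x / a ^ 3 := by
    rw [hw', hHa]; field_simp; ring
  have hnum : U ^ 4 * x ^ 2 + 2 * U ^ 2 * (U + 1) ^ 2 * x + 1 + 4 * U + 6 * U ^ 2 + 2 * U ^ 3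
      - U ^ 4 = a ^ 2 - 2 * U ^ 3 * (1 + U) := by rw [ha_def]; ring
  refine ⟨?_, ?_, ?_, ?_⟩
  · rw [hw3]; positivity
  · rw [hw3, hw', krewerasR₁, ← ha_def]; field_simp
  · have e : x * w ^ 2 * c ^ 2 = x * U ^ 2 / (1 + U) ^ 2 := by rw [hw', hc']; field_simp
    rw [e, hx, hc']; field_simp; ring
  · rw [hw3, krewerasR₂, hnum, ← ha_def, hw', hc']; field_simp

theorem RatFunc.algebraMap_ne_zero_of_eval_zero {K : Type*} [Field K] {p : Polynomial K}
    (hp : p.eval 0 ≠ 0) : algebraMap (Polynomial K) (RatFunc K) p ≠ 0 := by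
  refine (map_ne_zero_iff _ (RatFunc.algebraMap_injective K)).2 ?_
  rintro rfl
  simp at hp

theorem krewerasP_krewerasR_eq_zero :
    krewerasP
      (krewerasR₂ (RatFunc.X : RatFunc (RatFunc ℚ)) (RatFunc.C RatFunc.X))
      (krewerasR₁ (RatFunc.X : RatFunc (RatFunc ℚ)) (RatFunc.C RatFunc.X))
      (RatFunc.C RatFunc.X) = 0 := by
  have h2 : (2 : RatFunc (RatFunc ℚ)) ≠ 0 := two_ne_zero
  let X' : Polynomial (RatFunc ℚ) := Polynomial.X
  let x' : Polynomial (RatFunc ℚ) := Polynomial.C RatFunc.X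
  have eX : (RatFunc.X : RatFunc (RatFunc ℚ)) = algebraMap _ _ X' := RatFunc.algebraMap_X.symm
  have ex : (RatFunc.C RatFunc.X : RatFunc (RatFunc ℚ)) = algebraMap _ _ x' :=
    (RatFunc.algebraMap_C _).symm
  have hU0 : (RatFunc.X : RatFunc (RatFunc ℚ)) ≠ 0 := RatFunc.X_ne_zero
  have hU : (1 + RatFunc.X : RatFunc (RatFunc ℚ)) ≠ 0 := by
    have := RatFunc.algebraMap_ne_zero_of_eval_zero (p := 1 + X') (by simp [X'])
    simpa [eX] using this
  have ha : (1 + 2 * RatFunc.X + RatFunc.X ^ 2 + RatFunc.X ^ 2 * RatFunc.C (RatFunc.X : RatFunc ℚ) :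
      RatFunc (RatFunc ℚ)) ≠ 0 := by
    have := RatFunc.algebraMap_ne_zero_of_eval_zero (p := 1 + 2 * X' + X' ^ 2 + X' ^ 2 * x')
      (by simp [X'])
    rw [eX, ex]
    simpa only [map_add, map_mul, map_pow, map_one, _root_.map_ofNat] using this
  have hH : krewerasH (RatFunc.X : RatFunc (RatFunc ℚ)) (RatFunc.C RatFunc.X) ≠ 0 := by
    have := RatFunc.algebraMap_ne_zero_of_eval_zero (p := krewerasH X' x')
      (by simp [X', krewerasH])
    rwa [map_krewerasH, ← eX, ← ex] at this
  generalize (RatFunc.X : RatFunc (RatFunc ℚ)) = U at *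
  generalize (RatFunc.C RatFunc.X : RatFunc (RatFunc ℚ)) = x at *
  have h2U : 2 * (1 + U) ^ 2 ≠ 0 := mul_ne_zero h2 (pow_ne_zero 2 hU)
  obtain ⟨hw3, h1, hc, hR⟩ := krewerasR_of_param
    (w := 2 * U * (1 + U) / (1 + 2 * U + U ^ 2 + U ^ 2 * x))
    (c := (1 + 2 * U + U ^ 2 + U ^ 2 * x) / (2 * (1 + U) ^ 2)) h2 hU ha hH
    (div_mul_cancel₀ _ ha) (by field_simp)
  exact krewerasP_eq_zero_of_param h2 (div_ne_zero (mul_ne_zero (mul_ne_zero h2 hU0) hU) ha)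
    (div_ne_zero ha h2U) hw3 h1 hc hR

/-! ### The section `y = 0` -/

/-- The section `F(t; x, 0)` in terms of the algebraic series `w = t (2 + w³)` and
`c = (1 - √(1 - x w²)) / (x w²)`. -/
theorem exists_krewerasSectionSeries_eq : ∃ w c : PowerSeries (PowerSeries ℚ),
    serT * (2 + w ^ 3) = w ∧ 2 * c = 1 + serX * w ^ 2 * c ^ 2 ∧
      2 * krewerasSectionSeries = (2 + w ^ 3) * (2 * c - w ^ 3 * c ^ 2) := by
  obtain ⟨W, c, d, δ, h⟩ := exists_isKrewerasParam_krewerasGF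
  have hm := (h.map (MvPolynomial.aeval ![(Polynomial.X : Polynomial ℚ), 0]).toRingHom).map
    Polynomial.coeToPowerSeries.ringHom
  have hx : PowerSeries.map Polynomial.coeToPowerSeries.ringHom
      (PowerSeries.map (MvPolynomial.aeval ![(Polynomial.X : Polynomial ℚ), 0]).toRingHom
        (PowerSeries.C (MvPolynomial.X 0 : MvPolynomial (Fin 2) ℚ))) = serX := by
    rw [PowerSeries.map_C, PowerSeries.map_C]
    simp [serX, Polynomial.coeToPowerSeries.ringHom_apply]
  have hy : PowerSeries.map Polynomial.coeToPowerSeries.ringHom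
      (PowerSeries.map (MvPolynomial.aeval ![(Polynomial.X : Polynomial ℚ), 0]).toRingHom
        (PowerSeries.C (MvPolynomial.X 1 : MvPolynomial (Fin 2) ℚ))) = 0 := by
    simp
  rw [hx, hy] at hm
  have hx0 : serX ≠ 0 := (map_ne_zero_iff _ PowerSeries.C_injective).2 PowerSeries.X_ne_zero
  exact ⟨_, _, hm.eq_W, hm.eq_c,
    two_mul_closedForm_of_eq_zero hx0 rfl hm.eq_c hm.eq_d hm.eq_δ hm.eq_G⟩

theorem toFrac_injective : Function.Injective toFrac :=
  IsFractionRing.injective _ _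

theorem two_ne_zero_fractionRing : (2 : FractionRing (PowerSeries (PowerSeries ℚ))) ≠ 0 := by
  have h : toFrac 2 = 2 := _root_.map_ofNat _ 2
  rw [← h]
  exact (map_ne_zero_iff _ toFrac_injective).2 (two_ne_zero_of_algebra_rat _)

/-- `P(T, t, x)` has at most one root in `ℚ[[x, t]]`, since its derivative in `T` is `-x` modulo
`t`. -/
theorem krewerasP_root_unique {S T : PowerSeries (PowerSeries ℚ)}
    (hS : krewerasP S serT serX = 0) (hT : krewerasP T serT serX = 0) : S = T := by
  -- the quotient of `P(S) - P(T)` by `S - T`, with the terms divisible by `t` collected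
  obtain ⟨Q, hQ⟩ : ∃ Q, krewerasP S serT serX - krewerasP T serT serX =
      (S - T) * (-serX + serT * Q) := by
    generalize serT = t
    generalize serX = x
    refine ⟨(96 * x ^ 2 * t ^ 4 - 48 * x ^ 3 * t ^ 3 - 144 * t ^ 3 + 104 * x * t ^ 2
        - 16 * x ^ 2 * t + 2)
      + (48 * x ^ 4 * t ^ 5 + 192 * x * t ^ 5 - 264 * x ^ 2 * t ^ 4 + 64 * x ^ 3 * t ^ 3
        + 32 * t ^ 3 - 32 * x * t ^ 2 + 9 * x ^ 2 * t) * (S + T)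
      + (192 * x ^ 3 * t ^ 6 + 128 * t ^ 6 - 96 * x ^ 4 * t ^ 5 - 192 * x * t ^ 5
        + 128 * x ^ 2 * t ^ 4 - 32 * x ^ 3 * t ^ 3) * (S ^ 2 + S * T + T ^ 2)
      + (48 * x ^ 5 * t ^ 7 + 192 * x ^ 2 * t ^ 7 - 192 * x ^ 3 * t ^ 6 + 56 * x ^ 4 * t ^ 5)
        * (S ^ 3 + S ^ 2 * T + S * T ^ 2 + T ^ 3)
      + (96 * x ^ 4 * t ^ 8 - 48 * x ^ 5 * t ^ 7)
        * (S ^ 4 + S ^ 3 * T + S ^ 2 * T ^ 2 + S * T ^ 3 + T ^ 4)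
      + 16 * x ^ 6 * t ^ 9 * (S ^ 5 + S ^ 4 * T + S ^ 3 * T ^ 2 + S ^ 2 * T ^ 3 + S * T ^ 4
        + T ^ 5), ?_⟩
    unfold krewerasP
    ring
  rw [hS, hT, sub_zero, eq_comm, mul_eq_zero, sub_eq_zero] at hQ
  refine hQ.resolve_right fun h => ?_
  have := congrArg PowerSeries.constantCoeff h
  simp [serX, serT, PowerSeries.X_ne_zero] at this

theorem natDegree_krewerasP :
    (krewerasP (Polynomial.X : Polynomial (Polynomial (Polynomial ℚ)))
      (Polynomial.C Polynomial.X) (Polynomial.C (Polynomial.C Polynomial.X))).natDegree = 6 := by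
  obtain ⟨a, ha⟩ : ∃ a : ℕ → Polynomial (Polynomial ℚ),
      krewerasP (Polynomial.X : Polynomial (Polynomial (Polynomial ℚ)))
        (Polynomial.C Polynomial.X) (Polynomial.C (Polynomial.C Polynomial.X)) =
      Polynomial.C (a 0) + Polynomial.C (a 1) * Polynomial.X
        + Polynomial.C (a 2) * Polynomial.X ^ 2 + Polynomial.C (a 3) * Polynomial.X ^ 3
        + Polynomial.C (a 4) * Polynomial.X ^ 4 + Polynomial.C (a 5) * Polynomial.X ^ 5
        + Polynomial.C (16 * Polynomial.C Polynomial.X ^ 6 * Polynomial.X ^ 10)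
          * Polynomial.X ^ 6 := by
    generalize hx : (Polynomial.C Polynomial.X : Polynomial (Polynomial ℚ)) = x
    generalize ht : (Polynomial.X : Polynomial (Polynomial ℚ)) = t
    refine ⟨fun n => match n with
      | 0 => 16 * x ^ 3 * t ^ 4 + 108 * t ^ 4 - 72 * x * t ^ 3 + 8 * x ^ 2 * t ^ 2 - 2 * t + x
      | 1 => 96 * x ^ 2 * t ^ 5 - 48 * x ^ 3 * t ^ 4 - 144 * t ^ 4 + 104 * x * t ^ 3
          - 16 * x ^ 2 * t ^ 2 + 2 * t - x
      | 2 => 48 * x ^ 4 * t ^ 6 + 192 * x * t ^ 6 - 264 * x ^ 2 * t ^ 5 + 64 * x ^ 3 * t ^ 4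
          + 32 * t ^ 4 - 32 * x * t ^ 3 + 9 * x ^ 2 * t ^ 2
      | 3 => 192 * x ^ 3 * t ^ 7 + 128 * t ^ 7 - 96 * x ^ 4 * t ^ 6 - 192 * x * t ^ 6
          + 128 * x ^ 2 * t ^ 5 - 32 * x ^ 3 * t ^ 4
      | 4 => 48 * x ^ 5 * t ^ 8 + 192 * x ^ 2 * t ^ 8 - 192 * x ^ 3 * t ^ 7 + 56 * x ^ 4 * t ^ 6
      | _ => 96 * x ^ 4 * t ^ 9 - 48 * x ^ 5 * t ^ 8, ?_⟩
    simp [krewerasP, _root_.map_ofNat]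
  have hlead : (16 * Polynomial.C Polynomial.X ^ 6 * Polynomial.X ^ 10 :
      Polynomial (Polynomial ℚ)) ≠ 0 := by
    simp [Polynomial.X_ne_zero]
  rw [ha]
  compute_degree!

theorem krewerasP_krewerasSectionSeries : krewerasP krewerasSectionSeries serT serX = 0 := by
  obtain ⟨w, c, hw, hc, hS⟩ := exists_krewerasSectionSeries_eq
  have h2 := two_ne_zero_fractionRing
  have hw0 := ne_zero_of_X_mul_two_add_cube hw
  have hc0 : c ≠ 0 := by
    rintro rfl
    simp at hc
  have hw3 : 2 + w ^ 3 ≠ 0 := fun h => hw0 (by rw [← hw, h, mul_zero])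
  have e2 : toFrac 2 = 2 := _root_.map_ofNat _ 2
  have e3 : toFrac (2 + w ^ 3) = 2 + toFrac w ^ 3 := by simp [e2]
  refine (map_eq_zero_iff _ toFrac_injective).1 ?_
  rw [map_krewerasP]
  refine krewerasP_eq_zero_of_param (w := toFrac w) (c := toFrac c) h2
    ((map_ne_zero_iff _ toFrac_injective).2 hw0) ((map_ne_zero_iff _ toFrac_injective).2 hc0)
    (e3 ▸ (map_ne_zero_iff _ toFrac_injective).2 hw3) ?_ ?_ (mul_left_cancel₀ h2 ?_)
  · simpa [e2] using congrArg toFrac hw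
  · simpa [e2] using congrArg toFrac hc
  · have := congrArg toFrac hS
    simp only [map_mul, map_sub, map_pow, e2, e3] at this
    rw [this]
    field_simp

/-- A series `U` with zero constant term makes the denominators of `R₁(U, x)` and `R₂(U, x)`
units. -/
theorem krewerasR_denominators {U : PowerSeries (PowerSeries ℚ)}
    (hU : PowerSeries.constantCoeff U = 0) :
    IsUnit (1 + U) ∧ IsUnit (1 + 2 * U + U ^ 2 + U ^ 2 * serX) ∧ IsUnit (krewerasH U serX) := by
  simp only [PowerSeries.isUnit_iff_constantCoeff]
  simp [hU, krewerasH]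

theorem exists_krewerasR_uniformization : ∃ U₀ : PowerSeries (PowerSeries ℚ),
    (∀ U : PowerSeries (PowerSeries ℚ),
      (PowerSeries.constantCoeff U = 0 ∧
        krewerasR₁ (toFrac U) (toFrac serX) = toFrac serT) ↔ U = U₀) ∧
    toFrac krewerasSectionSeries = krewerasR₂ (toFrac U₀) (toFrac serX) := by
  obtain ⟨w, c, hw, hc, hS⟩ := exists_krewerasSectionSeries_eq
  have h2 := two_ne_zero_fractionRing
  have e2 : toFrac 2 = 2 := _root_.map_ofNat _ 2
  have h2' : (2 : PowerSeries (PowerSeries ℚ)) ≠ 0 := two_ne_zero_of_algebra_rat _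
  have hw0 : PowerSeries.constantCoeff w = 0 :=
    PowerSeries.X_dvd_iff.1 (X_dvd_of_X_mul_two_add_cube hw)
  -- `U₀ / (1 + U₀) = c w`
  have hu : IsUnit (1 - c * w) := by
    rw [PowerSeries.isUnit_iff_constantCoeff]
    simp [hw0]
  obtain ⟨u, hu'⟩ := hu.exists_right_inv
  have hU₀ : PowerSeries.constantCoeff (c * w * u) = 0 := by simp [hw0]
  -- the rational reparametrization, applied in the fraction field to series `U`, `v`, `d`
  have param : ∀ {U v d : PowerSeries (PowerSeries ℚ)}, PowerSeries.constantCoeff U = 0 →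
      v * (1 + 2 * U + U ^ 2 + U ^ 2 * serX) = 2 * U * (1 + U) →
      2 * d * (1 + U) ^ 2 = 1 + 2 * U + U ^ 2 + U ^ 2 * serX →
      2 + toFrac v ^ 3 ≠ 0 ∧
      krewerasR₁ (toFrac U) (toFrac serX) * (2 + toFrac v ^ 3) = toFrac v ∧
      2 * toFrac d = 1 + toFrac serX * toFrac v ^ 2 * toFrac d ^ 2 ∧
      krewerasR₂ (toFrac U) (toFrac serX) =
        (2 + toFrac v ^ 3) * (toFrac d - toFrac v ^ 3 * toFrac d ^ 2 / 2) := by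
    intro U v d hU hv hd
    obtain ⟨n1, n2, n3⟩ := krewerasR_denominators hU
    have n1' := (n1.map toFrac).ne_zero
    have n2' := (n2.map toFrac).ne_zero
    have n3' := (n3.map toFrac).ne_zero
    rw [map_krewerasH] at n3'
    have hv' := congrArg toFrac hv
    have hd' := congrArg toFrac hd
    simp only [map_add, map_mul, map_pow, map_one, e2] at n1' n2' hv' hd'
    exact krewerasR_of_param h2 n1' n2' n3' hv' hd'
  have hUu : c * w * u = c * w * (1 + c * w * u) := by linear_combination (c * w) * hu'
  have h1U : (1 - c * w) * (1 + c * w * u) = 1 := by linear_combination (c * w) * hu'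
  have hc1 : 2 * c * (1 + c * w * u) ^ 2 =
      1 + 2 * (c * w * u) + (c * w * u) ^ 2 + (c * w * u) ^ 2 * serX := by
    generalize c * w * u = U at hUu
    linear_combination (1 + U) ^ 2 * hc - serX * (U + c * w * (1 + U)) * hUu
  have hw1 : w * (1 + 2 * (c * w * u) + (c * w * u) ^ 2 + (c * w * u) ^ 2 * serX) =
      2 * (c * w * u) * (1 + c * w * u) := by
    rw [← hc1]
    generalize c * w * u = U at hUu
    linear_combination (-2 * (1 + U)) * hUu
  obtain ⟨hw3, hR1, -, hR2⟩ := param hU₀ hw1 hc1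
  have hwF : toFrac serT * (2 + toFrac w ^ 3) = toFrac w := by
    simpa [e2] using congrArg toFrac hw
  refine ⟨c * w * u, fun U => ⟨fun ⟨hU, hR⟩ => ?_, ?_⟩, ?_⟩
  · obtain ⟨n1, n2, -⟩ := krewerasR_denominators hU
    obtain ⟨b, hb⟩ := n2.exists_right_inv
    obtain ⟨r, hr⟩ := n1.exists_right_inv
    obtain ⟨q, hq⟩ := (isUnit_two_of_algebra_rat (PowerSeries (PowerSeries ℚ))).exists_right_inv
    set a := 1 + 2 * U + U ^ 2 + U ^ 2 * serX with ha
    -- the parameters `w` and `c` attached to `U` satisfy the equations that determine them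
    have hv : 2 * U * (1 + U) * b * a = 2 * U * (1 + U) := by
      linear_combination 2 * U * (1 + U) * hb
    have hd : 2 * (q * a * r ^ 2) * (1 + U) ^ 2 = a := by
      linear_combination a * ((1 + U) * r) ^ 2 * hq + a * ((1 + U) * r + 1) * hr
    obtain ⟨-, hvR, hdR, -⟩ := param hU hv hd
    rw [hR] at hvR
    have hvw : 2 * U * (1 + U) * b = w :=
      (existsUnique_eq_X_mul_two_add_cube _).unique (toFrac_injective (by
        simpa only [map_add, map_mul, map_pow, e2, serT] using hvR)) hw
    rw [hvw] at hv hdR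
    have hdc : q * a * r ^ 2 = c :=
      (existsUnique_two_mul_eq serX (X_dvd_of_X_mul_two_add_cube hw)).unique (toFrac_injective (by
        simpa only [map_add, map_mul, map_pow, map_one, e2] using hdR)) hc
    rw [hdc] at hd
    have hUc : U = c * w * (1 + U) := mul_left_cancel₀ (mul_ne_zero h2' n1.ne_zero) (by
      linear_combination (-1 : PowerSeries (PowerSeries ℚ)) * hv - w * hd)
    exact hu.mul_left_cancel (by linear_combination hUc - c * w * hu')
  · rintro rfl
    exact ⟨hU₀, mul_right_cancel₀ hw3 (hR1.trans hwF.symm)⟩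
  · refine mul_left_cancel₀ h2 ?_
    have := congrArg toFrac hS
    simp only [map_mul, map_sub, map_add, map_pow, e2] at this
    rw [this, hR2]
    field_simp

theorem theorem5 :
    -- `F(t; x, y)` is algebraic over `ℚ[x, y][t]`
    IsAlgebraic (Polynomial (MvPolynomial (Fin 2) ℚ)) krewerasGF ∧
    -- `P(T, t, x)`, as a polynomial in `T` over `ℚ[x][t]`, has degree 6
    (krewerasP (Polynomial.X : Polynomial (Polynomial (Polynomial ℚ)))
      (Polynomial.C Polynomial.X) (Polynomial.C (Polynomial.C Polynomial.X))).natDegree = 6 ∧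
    -- `F(t; x, 0)` is a root of `P` in `ℚ[[x, t]]`, and the only one
    (∀ S : PowerSeries (PowerSeries ℚ),
      krewerasP S serT serX = 0 ↔ S = krewerasSectionSeries) ∧
    -- `P(R₂(U, x), R₁(U, x), x) = 0` in `ℚ(x)(U)`
    krewerasP
      (krewerasR₂ (RatFunc.X : RatFunc (RatFunc ℚ)) (RatFunc.C RatFunc.X))
      (krewerasR₁ (RatFunc.X : RatFunc (RatFunc ℚ)) (RatFunc.C RatFunc.X))
      (RatFunc.C RatFunc.X) = 0 ∧
    -- there is exactly one `U₀` in `ℚ[[x, t]]` with `U₀(0, x) = 0` and `R₁(U₀, x) = t`,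
    -- and `F(t; x, 0) = R₂(U₀, x)`
    (∃ U₀ : PowerSeries (PowerSeries ℚ),
      (∀ U : PowerSeries (PowerSeries ℚ),
        (PowerSeries.constantCoeff U = 0 ∧
          krewerasR₁ (toFrac U) (toFrac serX) = toFrac serT) ↔ U = U₀) ∧
      toFrac krewerasSectionSeries = krewerasR₂ (toFrac U₀) (toFrac serX)) := by
  refine ⟨krewerasGF_isAlgebraic, natDegree_krewerasP, fun S => ⟨fun hS => ?_, ?_⟩,
    krewerasP_krewerasR_eq_zero, exists_krewerasR_uniformization⟩
  · exact krewerasP_root_unique hS krewerasP_krewerasSectionSeries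
  · rintro rfl
    exact krewerasP_krewerasSectionSeries
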